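/- Let $S_n$ be the group of permutations of $\{1,\dots,n\}$, a permutation being written in one-line notation $\pi=[\pi(1),\dots,\pi(n)]$, so that the position of element $i$ in $\pi$ is $\pi^{-1}(i)$. Two permutations $\pi,\rho\in S_n$ are \emph{adjacent} if $|\pi^{-1}(i)-\rho^{-1}(i)|\le 1$ for every $i$. A \emph{tangle} is a finite sequence of permutations in which each consecutive pair is adjacent; it \emph{performs} $\pi$ if it starts with the identity permutation and ends with $\pi$. \emph{Path} $i$ of the tangle is the sequence of positions of element $i$ in the successive permutations. A \emph{move} in path $i$ is a maximal block of at least two consecutive permutations of the tangle over which the positions of $i$ form an arithmetic progression with common difference $+1$ or $-1$. \textbf{Theorem.} For any permutation $\pi\in S_n$, there is a tangle performing $\pi$ that has at most $5$ moves in each path. -/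

import Mathlib

/-- A permutation `π` is read in one-line notation `[π 0, …, π (n-1)]` (elements and positions are
indexed by `Fin n`), so element `i` sits at position `π⁻¹ i`. -/
def position {n : ℕ} (π : Equiv.Perm (Fin n)) (i : Fin n) : ℤ := ((π⁻¹ i : Fin n) : ℕ)

/-- Every element changes its position by at most one. -/
def PermAdjacent {n : ℕ} (π ρ : Equiv.Perm (Fin n)) : Prop :=
  ∀ i, |position π i - position ρ i| ≤ 1

/-- A finite (nonempty) sequence of permutations in which each consecutive pair is adjacent.
`len` is the number of steps, so that there are `len + 1` permutations. -/
structure Tangle (n : ℕ) where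
  len : ℕ
  perm : Fin (len + 1) → Equiv.Perm (Fin n)
  adjacent : ∀ t : Fin len, PermAdjacent (perm t.castSucc) (perm t.succ)

namespace Tangle

variable {n : ℕ}

/-- The tangle starts with the identity and ends with `π`. -/
def Performs (T : Tangle n) (π : Equiv.Perm (Fin n)) : Prop :=
  T.perm 0 = 1 ∧ T.perm (Fin.last T.len) = π

/-- Between times `a < b` the positions of element `i` form an arithmetic progression of common
difference `d`. -/
def IsRun (T : Tangle n) (i : Fin n) (d : ℤ) (a b : Fin (T.len + 1)) : Prop :=
  a < b ∧ ∀ t : Fin T.len, a ≤ t.castSucc → t.succ ≤ b →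
    position (T.perm t.succ) i - position (T.perm t.castSucc) i = d

/-- Path `i` is a non-vertical straight segment between times `a < b`. -/
def IsSlanted (T : Tangle n) (i : Fin n) (a b : Fin (T.len + 1)) : Prop :=
  T.IsRun i 1 a b ∨ T.IsRun i (-1) a b

/-- A move of element `i`: a maximal non-vertical segment of path `i`. -/
def IsMove (T : Tangle n) (i : Fin n) (a b : Fin (T.len + 1)) : Prop :=
  T.IsSlanted i a b ∧
    ∀ a' b', a' ≤ a → b ≤ b' → T.IsSlanted i a' b' → a' = a ∧ b' = b

/-- The number of moves in path `i`. -/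
noncomputable def moves (T : Tangle n) (i : Fin n) : ℕ :=
  {p : Fin (T.len + 1) × Fin (T.len + 1) | T.IsMove i p.1 p.2}.ncard

end Tangle

/-! Write `π⁻¹` as `K ∘ J` with `J`, `K` involutions. Each position `p` carries a line that starts
and ends at `p`. It first moves left if `P p` and right otherwise; `Q` does the same for the
reversed line. These lines never collide and each has at most three moves (`line_ne_of_lt`,
`line_runs`).

Let `P p` mean `J p ≤ p` and `Q p` mean `K p ≤ p`. The two lines of a 2-cycle of `J` then head
towards each other and cross, each having made at most one move (`line_cross`,
`line_runs_before_cross`). Element `e` rides its own line up to that crossing, rests for one step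
instead of crossing, and goes on along the line of `J e`. By time reversal it later changes in the
same way to the line of `K (J e)`, where it ends. All changes for `J` precede those for `K`
(`crossTime_separated`), so a path has at most 1 + 3 + 1 moves. -/

/-- The number of `k < p` satisfying `R`. -/
noncomputable def countBelow (R : ℕ → Prop) (p : ℕ) : ℕ := by
  classical exact Nat.count R p

theorem countBelow_mono (R : ℕ → Prop) {p q : ℕ} (h : p ≤ q) :
    countBelow R p ≤ countBelow R q := by
  classical exact Nat.count_monotone R h

theorem countBelow_lt {R : ℕ → Prop} {p q : ℕ} (hp : R p) (h : p < q) :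
    countBelow R p < countBelow R q := by
  classical exact Nat.count_strict_mono hp h

theorem countBelow_four (P Q : ℕ → Prop) (p : ℕ) :
    countBelow (fun k => P k ∧ Q k) p + countBelow (fun k => P k ∧ ¬ Q k) p +
      countBelow (fun k => ¬ P k ∧ Q k) p + countBelow (fun k => ¬ P k ∧ ¬ Q k) p = p := by
  classical
  induction p with
  | zero => simp [countBelow]
  | succ p ih =>
    simp only [countBelow, Nat.count_succ] at ih ⊢
    by_cases hP : P p <;> by_cases hQ : Q p <;> simp [hP, hQ] <;> omega

/-! ### The system of lines -/

/-- Total time of the system of lines on `n` positions, `U` of which have neither colour. -/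
def lineTime (n U : ℤ) : ℤ := 6 * n - 2 * U + 1

/-- A line that moves left, waits at the left end, and moves back. -/
def lineAA (n U p x y z _u t : ℤ) : ℤ :=
  min p (max (max (1 + 2 * (x + y) + 2 * n - t)
    (1 + 2 * (x + z) + 2 * n - (lineTime n U - t))) x)

/-- A line that moves right, waits at the right end, and moves back. -/
def lineBB (n U p _x y z u t : ℤ) : ℤ :=
  max p (min (min (t - 2 * n + 2 * (z + u))
    (lineTime n U - t - 2 * n + 2 * (y + u))) (n - U + u))

/-- A line that moves left, then right, then left. -/
def lineAB (n U p x y _z u t : ℤ) : ℤ :=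
  max (min p (1 + 2 * (x + y) + 2 * n - t))
    (min (t - 2 - 2 * n - 2 * y) (max p (lineTime n U - t - 2 * n + 2 * (y + u))))

open Classical in
/-- The position at time `t` of the line that starts and ends at position `p`. -/
noncomputable def line (P Q : ℕ → Prop) (n p : ℕ) (t : ℤ) : ℤ :=
  let x := countBelow (fun k => P k ∧ Q k) p
  let y := countBelow (fun k => P k ∧ ¬ Q k) p
  let z := countBelow (fun k => ¬ P k ∧ Q k) p
  let u := countBelow (fun k => ¬ P k ∧ ¬ Q k) p
  let U := countBelow (fun k => ¬ P k ∧ ¬ Q k) n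
  if P p then
    if Q p then lineAA n U p x y z u t else lineAB n U p x y z u t
  else
    -- Right-left-right is left-right-left in reversed time, which exchanges `P` with `Q` and hence
    -- `y` with `z`.
    if Q p then lineAB n U p x z y u (lineTime n U - t) else lineBB n U p x y z u t

/-- The linear relations between the numbers of positions of each kind below `p ≤ n`. -/
theorem countBelow_facts (P Q : ℕ → Prop) {n p : ℕ} (hp : p ≤ n) :
    ∃ x y z u X Y Z U : ℕ,
      countBelow (fun k => P k ∧ Q k) p = x ∧ countBelow (fun k => P k ∧ ¬ Q k) p = y ∧
      countBelow (fun k => ¬ P k ∧ Q k) p = z ∧ countBelow (fun k => ¬ P k ∧ ¬ Q k) p = u ∧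
      countBelow (fun k => P k ∧ Q k) n = X ∧ countBelow (fun k => P k ∧ ¬ Q k) n = Y ∧
      countBelow (fun k => ¬ P k ∧ Q k) n = Z ∧ countBelow (fun k => ¬ P k ∧ ¬ Q k) n = U ∧
      x + y + z + u = p ∧ X + Y + Z + U = n ∧ x ≤ X ∧ y ≤ Y ∧ z ≤ Z ∧ u ≤ U ∧
      (p < n → (P p → Q p → x < X) ∧ (P p → ¬ Q p → y < Y) ∧
        (¬ P p → Q p → z < Z) ∧ (¬ P p → ¬ Q p → u < U)) :=
  ⟨_, _, _, _, _, _, _, _, rfl, rfl, rfl, rfl, rfl, rfl, rfl, rfl,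
    countBelow_four P Q p, countBelow_four P Q n,
    countBelow_mono _ hp, countBelow_mono _ hp, countBelow_mono _ hp, countBelow_mono _ hp,
    fun h => ⟨fun hP hQ => countBelow_lt ⟨hP, hQ⟩ h, fun hP hQ => countBelow_lt ⟨hP, hQ⟩ h,
      fun hP hQ => countBelow_lt ⟨hP, hQ⟩ h, fun hP hQ => countBelow_lt ⟨hP, hQ⟩ h⟩⟩

theorem line_mem (P Q : ℕ → Prop) {n p : ℕ} (hp : p < n) (t : ℤ) :
    0 ≤ line P Q n p t ∧ line P Q n p t < n := by
  obtain ⟨x, y, z, u, X, Y, Z, U, h1, h2, h3, h4, h5, h6, h7, h8, e, E, hx, hy, hz, hu, hh⟩ :=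
    countBelow_facts P Q hp.le
  obtain ⟨k1, k2, k3, k4⟩ := hh hp
  simp only [line, h1, h2, h3, h4, h8]
  by_cases hP : P p <;> by_cases hQ : Q p <;>
    simp only [hP, hQ, if_true, if_false, lineAA, lineAB, lineBB, lineTime, true_imp_iff,
      not_true, not_false_iff, false_imp_iff] at k1 k2 k3 k4 ⊢ <;> omega

theorem line_step (P Q : ℕ → Prop) {n p : ℕ} (hp : p < n) (t : ℤ) :
    |line P Q n p t - line P Q n p (t + 1)| ≤ 1 := by
  obtain ⟨x, y, z, u, X, Y, Z, U, h1, h2, h3, h4, h5, h6, h7, h8, e, E, hx, hy, hz, hu, hh⟩ :=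
    countBelow_facts P Q hp.le
  obtain ⟨k1, k2, k3, k4⟩ := hh hp
  simp only [line, h1, h2, h3, h4, h8, abs_le]
  by_cases hP : P p <;> by_cases hQ : Q p <;>
    simp only [hP, hQ, if_true, if_false, lineAA, lineAB, lineBB, lineTime, true_imp_iff,
      not_true, not_false_iff, false_imp_iff] at k1 k2 k3 k4 ⊢ <;> omega

theorem line_zero (P Q : ℕ → Prop) {n p : ℕ} (hp : p < n) : line P Q n p 0 = p := by
  obtain ⟨x, y, z, u, X, Y, Z, U, h1, h2, h3, h4, h5, h6, h7, h8, e, E, hx, hy, hz, hu, hh⟩ :=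
    countBelow_facts P Q hp.le
  obtain ⟨k1, k2, k3, k4⟩ := hh hp
  simp only [line, h1, h2, h3, h4, h8]
  by_cases hP : P p <;> by_cases hQ : Q p <;>
    simp only [hP, hQ, if_true, if_false, lineAA, lineAB, lineBB, lineTime, true_imp_iff,
      not_true, not_false_iff, false_imp_iff] at k1 k2 k3 k4 ⊢ <;> omega

-- Parity separates opposite directions: position minus time is even on every rightward stretch,
-- position plus time is odd on every leftward one. Such lines swap adjacent cells between two times
-- and never share a cell.
set_option maxHeartbeats 8000000 in
theorem line_ne_of_lt (P Q : ℕ → Prop) {n p q : ℕ} (hpq : p < q) (hq : q < n) (t : ℤ) :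
    line P Q n p t ≠ line P Q n q t := by
  obtain ⟨x, y, z, u, x', y', z', u', h1, h2, h3, h4, h5, h6, h7, h8, e, E, hx, hy, hz, hu, hh⟩ :=
    countBelow_facts P Q hpq.le
  obtain ⟨k1, k2, k3, k4⟩ := hh hpq
  obtain ⟨_, _, _, _, X, Y, Z, U, g1, g2, g3, g4, g5, g6, g7, g8, e', E', hx', hy', hz', hu', hh'⟩ :=
    countBelow_facts P Q hq.le
  obtain ⟨l1, l2, l3, l4⟩ := hh' hq
  rw [h5] at g1; rw [h6] at g2; rw [h7] at g3; rw [h8] at g4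
  subst g1 g2 g3 g4
  simp only [line, h1, h2, h3, h4, h5, h6, h7, h8, g8]
  clear hh hh' h1 h2 h3 h4 h5 h6 h7 h8 g5 g6 g7 g8
  by_cases hP : P p <;> by_cases hQ : Q p <;> by_cases hP' : P q <;> by_cases hQ' : Q q <;>
    simp only [hP, hQ, hP', hQ', if_true, if_false, lineAA, lineAB, lineBB, lineTime, true_imp_iff,
      not_true, not_false_iff, false_imp_iff] at k1 k2 k3 k4 l1 l2 l3 l4 ⊢ <;> omega

/-! ### Crossings and time reversal -/

/-- Total time of the system of lines. -/
noncomputable def totalTime (P Q : ℕ → Prop) (n : ℕ) : ℤ :=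
  lineTime n (countBelow (fun k => ¬ P k ∧ ¬ Q k) n)

/-- The time at which the lines of `p` and `q`, of different colours with respect to `P`, cross. -/
noncomputable def crossTime (P : ℕ → Prop) (n p q : ℕ) : ℤ :=
  2 * n + countBelow P p + countBelow P q - min p q

theorem crossTime_comm (P : ℕ → Prop) (n p q : ℕ) : crossTime P n p q = crossTime P n q p := by
  unfold crossTime
  rw [min_comm]; ring

theorem countBelow_eq_add (P Q : ℕ → Prop) (p : ℕ) :
    countBelow P p = countBelow (fun k => P k ∧ Q k) p + countBelow (fun k => P k ∧ ¬ Q k) p := by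
  classical
  induction p with
  | zero => simp [countBelow]
  | succ p ih =>
    simp only [countBelow, Nat.count_succ] at ih ⊢
    by_cases hP : P p <;> by_cases hQ : Q p <;> simp [hP, hQ] <;> omega

theorem countBelow_le (P : ℕ → Prop) (p : ℕ) : countBelow P p ≤ p := by
  classical exact Nat.count_le _

theorem crossTime_nonneg (P : ℕ → Prop) {n p q : ℕ} (hp : p < n) : 0 ≤ crossTime P n p q := by
  unfold crossTime
  omega

theorem crossTime_lt (P : ℕ → Prop) {n p q : ℕ} (hpq : p ≤ q) (hq : q < n) (hP : P q) :
    crossTime P n p q < 2 * n + countBelow P n := by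
  have h1 := countBelow_le P p
  have h2 := countBelow_lt hP hq
  unfold crossTime
  omega

/-- The condition on the maximum fits a cycle of an involution, whose larger point is the one
satisfying `P`. -/
theorem crossTime_lt_max (P : ℕ → Prop) {n p q : ℕ} (hp : p < n) (hq : q < n)
    (hP : P (max p q)) : crossTime P n p q < 2 * n + countBelow P n := by
  rcases le_total p q with h | h
  · rw [max_eq_right h] at hP
    exact crossTime_lt P h hq hP
  · rw [max_eq_left h] at hP
    rw [crossTime_comm]
    exact crossTime_lt P h hp hP

/-- This symmetry lets every fact about `P` and the beginning serve for `Q` and the end. -/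
theorem line_reverse (P Q : ℕ → Prop) (n p : ℕ) (t : ℤ) :
    line P Q n p t = line Q P n p (totalTime P Q n - t) := by
  have c1 : (fun k => Q k ∧ P k) = fun k => P k ∧ Q k := by simp only [and_comm]
  have c2 : (fun k => Q k ∧ ¬ P k) = fun k => ¬ P k ∧ Q k := by simp only [and_comm]
  have c3 : (fun k => ¬ Q k ∧ P k) = fun k => P k ∧ ¬ Q k := by simp only [and_comm]
  have c4 : (fun k => ¬ Q k ∧ ¬ P k) = fun k => ¬ P k ∧ ¬ Q k := by simp only [and_comm]
  unfold line totalTime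
  simp only [c1, c2, c3, c4, sub_sub_cancel]
  by_cases hP : P p <;> by_cases hQ : Q p <;>
    simp only [hP, hQ, if_true, if_false, lineAA, lineBB, sub_sub_cancel]
  · rw [max_comm (1 + _ + _ - t)]
  · rw [min_comm (t - _ + _)]

/-- All crossings governed by `P` happen before those governed by `Q`. -/
theorem crossTime_separated (P Q : ℕ → Prop) (n : ℕ) :
    2 * n + countBelow P n + (2 * n + countBelow Q n) ≤ totalTime P Q n := by
  have h1 := countBelow_four P Q n
  have h2 := countBelow_eq_add P Q n
  have h3 := countBelow_eq_add Q P n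
  simp only [and_comm (a := Q _)] at h3
  simp only [totalTime, lineTime]
  omega

/-- At the latest time allowed, the rightward diagonal is past its crossings with all `P`-lines from
above `p`. -/
theorem line_eq_of_not (P Q : ℕ → Prop) {n p : ℕ} (hp : p < n) (hP : ¬ P p) {t : ℤ}
    (ht : t ≤ 2 * n + countBelow P n + countBelow P p - p) :
    line P Q n p t = max (p : ℤ) (t - 2 * n + 2 * (p - countBelow P p)) := by
  obtain ⟨x, y, z, u, X, Y, Z, U, h1, h2, h3, h4, h5, h6, h7, h8, e, E, hx, hy, hz, hu, hh⟩ :=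
    countBelow_facts P Q hp.le
  obtain ⟨k1, k2, k3, k4⟩ := hh hp
  clear hh
  simp only [countBelow_eq_add P Q, h1, h2, h5, h6] at ht ⊢
  simp only [line, h1, h2, h3, h4, h8]
  clear h1 h2 h3 h4 h5 h6 h7 h8
  by_cases hQ : Q p <;>
    simp only [hP, hQ, if_true, if_false, lineAB, lineBB, lineTime, true_imp_iff,
      not_true, not_false_iff, false_imp_iff] at k1 k2 k3 k4 ⊢ <;> omega

theorem line_eq_of (P Q : ℕ → Prop) {n p : ℕ} (hp : p < n) (hP : P p) {t : ℤ}
    (ht : t ≤ 2 * n + countBelow P p + 1) :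
    line P Q n p t = min (p : ℤ) (1 + 2 * countBelow P p + 2 * n - t) := by
  obtain ⟨x, y, z, u, X, Y, Z, U, h1, h2, h3, h4, h5, h6, h7, h8, e, E, hx, hy, hz, hu, hh⟩ :=
    countBelow_facts P Q hp.le
  obtain ⟨k1, k2, k3, k4⟩ := hh hp
  clear hh
  simp only [countBelow_eq_add P Q, h1, h2] at ht ⊢
  simp only [line, h1, h2, h3, h4, h8]
  clear h1 h2 h3 h4 h5 h6 h7 h8
  by_cases hQ : Q p <;>
    simp only [hP, hQ, if_true, if_false, lineAB, lineAA, lineTime, true_imp_iff,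
      not_true, not_false_iff, false_imp_iff] at k1 k2 k3 k4 ⊢ <;> omega

/-- Up to and just after the crossing of `p` and `q`, both lines have made at most one move. -/
theorem line_eq_of_le_crossTime (P Q : ℕ → Prop) {n p q : ℕ} (hpq : p < q) (hq : q < n)
    (hPp : ¬ P p) (hPq : P q) {t : ℤ} (ht : t ≤ crossTime P n p q + 1) :
    line P Q n p t = max (p : ℤ) (t - 2 * n + 2 * (p - countBelow P p)) ∧
      line P Q n q t = min (q : ℤ) (1 + 2 * countBelow P q + 2 * n - t) := by
  have h1 := countBelow_le P p
  have h2 := countBelow_lt hPq hq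
  unfold crossTime at ht
  exact ⟨line_eq_of_not P Q (hpq.trans hq) hPp (by omega), line_eq_of P Q hq hPq (by omega)⟩

theorem countBelow_sub_le (P : ℕ → Prop) {p q : ℕ} (h : p ≤ q) :
    countBelow P q + p ≤ countBelow P p + q := by
  have h1 := countBelow_four P P p
  have h2 := countBelow_four P P q
  have h3 := countBelow_eq_add P P p
  have h4 := countBelow_eq_add P P q
  have h5 := countBelow_mono (fun k => ¬ P k ∧ P k) h
  have h6 := countBelow_mono (fun k => ¬ P k ∧ ¬ P k) h
  omega

/-- Since the two lines exchange adjacent cells, changing lines here means standing still for one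
step. -/
theorem line_cross (P Q : ℕ → Prop) {n p q : ℕ} (hpq : p < q) (hq : q < n)
    (hPp : ¬ P p) (hPq : P q) :
    line P Q n p (crossTime P n p q) = line P Q n q (crossTime P n p q + 1) ∧
    line P Q n q (crossTime P n p q) = line P Q n p (crossTime P n p q + 1) := by
  obtain ⟨a1, a2⟩ := line_eq_of_le_crossTime P Q hpq hq hPp hPq (t := crossTime P n p q) (by omega)
  obtain ⟨b1, b2⟩ := line_eq_of_le_crossTime P Q hpq hq hPp hPq le_rfl
  have h1 := countBelow_mono P hpq.le
  have h2 := countBelow_sub_le P (Nat.succ_le_of_lt hpq)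
  rw [Nat.succ_eq_add_one] at h2
  have h3 : countBelow P (p + 1) = countBelow P p := by
    classical simp [countBelow, Nat.count_succ, hPp]
  rw [a1, a2, b1, b2]
  unfold crossTime
  omega

/-! ### Counting runs -/

/-- On the times in `[a, b)`, the steps of `g` consist of at most `k` runs of constant velocity
`1` or `-1`. -/
inductive Runs (g : ℤ → ℤ) : ℕ → ℤ → ℤ → Prop
  | rest {a b : ℤ} (h : ∀ t, a ≤ t → t < b → g (t + 1) - g t = 0) : Runs g 0 a b
  | run {a b : ℤ} (d : ℤ) (hd : d = 1 ∨ d = -1)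
      (h : ∀ t, a ≤ t → t < b → g (t + 1) - g t = d) : Runs g 1 a b
  | append {k l : ℕ} {a m b : ℤ} (h₁ : Runs g k a m) (h₂ : Runs g l m b) : Runs g (k + l) a b

namespace Runs

theorem of_le {g : ℤ → ℤ} (k : ℕ) {a b : ℤ} (h : b ≤ a) : Runs g k a b := by
  induction k with
  | zero => exact rest fun t h₁ h₂ => by omega
  | succ k ih =>
    exact append (m := b) ih (run 1 (Or.inl rfl) fun t h₁ h₂ => by omega)

theorem congr {g g' : ℤ → ℤ} {k : ℕ} {a b : ℤ} (h : Runs g k a b) {a' b' : ℤ} (ha : a ≤ a')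
    (hb : b' ≤ b) (hg : ∀ t, a' ≤ t → t ≤ b' → g' t = g t) : Runs g' k a' b' := by
  induction h generalizing a' b' with
  | rest h =>
    refine rest fun t h₁ h₂ => ?_
    rw [hg _ (by omega) (by omega), hg _ (by omega) (by omega)]
    exact h t (by omega) (by omega)
  | run d hd h =>
    refine run d hd fun t h₁ h₂ => ?_
    rw [hg _ (by omega) (by omega), hg _ (by omega) (by omega)]
    exact h t (by omega) (by omega)
  | @append k l a m b h₁ h₂ ih₁ ih₂ =>
    rcases lt_or_ge m a' with h | h
    · exact append (m := a') (of_le k le_rfl) (ih₂ (by omega) hb hg)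
    rcases lt_or_ge b' m with h' | h'
    · exact append (m := b') (ih₁ ha (by omega) hg) (of_le l le_rfl)
    · exact append (m := m) (ih₁ ha le_rfl fun t _ _ => hg t (by omega) (by omega))
        (ih₂ le_rfl hb fun t _ _ => hg t (by omega) (by omega))

theorem reverse {g : ℤ → ℤ} {k : ℕ} {a b : ℤ} (h : Runs g k a b) (T : ℤ) :
    Runs (fun t => g (T - t)) k (T - b) (T - a) := by
  induction h with
  | rest h =>
    refine rest fun t h₁ h₂ => ?_
    have := h (T - (t + 1)) (by omega) (by omega)
    rw [show T - (t + 1) + 1 = T - t by ring] at this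
    linarith
  | run d hd h =>
    refine run (-d) (by omega) fun t h₁ h₂ => ?_
    have := h (T - (t + 1)) (by omega) (by omega)
    rw [show T - (t + 1) + 1 = T - t by ring] at this
    linarith
  | append h₁ h₂ ih₁ ih₂ =>
    rw [add_comm]
    exact append ih₂ ih₁

theorem one_of {g : ℤ → ℤ} {a l b d : ℤ} (hd : d = 1 ∨ d = -1)
    (h : ∀ t, t < b → (t < l → g (t + 1) - g t = 0) ∧ (l ≤ t → g (t + 1) - g t = d)) :
    Runs g 1 a b := by
  rcases le_total l b with hl | hl
  · exact append (m := l) (rest fun t _ h₂ => (h t (by omega)).1 h₂)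
      (run d hd fun t h₁ h₂ => (h t h₂).2 h₁)
  · exact append (m := b) (rest fun t _ h₂ => (h t h₂).1 (by omega))
      (of_le 1 le_rfl)

/-- `append` does not require ordered endpoints, so `a` and `b` may lie anywhere relative to the
breakpoints. -/
theorem three_of {g : ℤ → ℤ} {a b l₁ h₁ l₂ h₂ l₃ h₃ d₁ d₂ d₃ : ℤ} (hd₁ : d₁ = 1 ∨ d₁ = -1)
    (hd₂ : d₂ = 1 ∨ d₂ = -1) (hd₃ : d₃ = 1 ∨ d₃ = -1)
    (h : ∀ t, (t < l₁ → g (t + 1) - g t = 0) ∧ (l₁ ≤ t → t < h₁ → g (t + 1) - g t = d₁) ∧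
      (h₁ ≤ t → t < l₂ → g (t + 1) - g t = 0) ∧ (l₂ ≤ t → t < h₂ → g (t + 1) - g t = d₂) ∧
      (h₂ ≤ t → t < l₃ → g (t + 1) - g t = 0) ∧ (l₃ ≤ t → t < h₃ → g (t + 1) - g t = d₃) ∧
      (h₃ ≤ t → g (t + 1) - g t = 0)) :
    Runs g 3 a b := by
  have r1 : Runs g 1 a h₁ := append (m := l₁) (rest fun t _ k => (h t).1 k)
    (run d₁ hd₁ fun t k k' => (h t).2.1 k k')
  have r2 : Runs g 1 h₁ h₂ := append (m := l₂) (rest fun t k k' => (h t).2.2.1 k k')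
    (run d₂ hd₂ fun t k k' => (h t).2.2.2.1 k k')
  have r3 : Runs g 1 h₂ h₃ := append (m := l₃) (rest fun t k k' => (h t).2.2.2.2.1 k k')
    (run d₃ hd₃ fun t k k' => (h t).2.2.2.2.2.1 k k')
  exact append (append (append r1 r2) r3) (rest fun t k _ => (h t).2.2.2.2.2.2 k)

end Runs

set_option maxHeartbeats 4000000 in
theorem line_runs (P Q : ℕ → Prop) {n p : ℕ} (hp : p < n) (a b : ℤ) :
    Runs (line P Q n p) 3 a b := by
  obtain ⟨x, y, z, u, X, Y, Z, U, h1, h2, h3, h4, h5, h6, h7, h8, e, E, hx, hy, hz, hu, hh⟩ :=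
    countBelow_facts P Q hp.le
  obtain ⟨k1, k2, k3, k4⟩ := hh hp
  unfold line
  simp only [h1, h2, h3, h4, h8]
  clear hh h1 h2 h3 h4 h5 h6 h7 h8
  -- Generalised over `y`, `z` and the interval so that the reversed colour class can reuse it.
  have ab : ∀ (a b : ℤ) (y z Y Z : ℕ), x + y + z + u = p → X + Y + Z + U = n → y < Y → z ≤ Z →
      Runs (lineAB n U p x y z u) 3 a b := by
    intro a b y z Y Z _ _ _ _
    -- The line turns at positions `x` and `n - U + u - 1`, resting one step at each turn.
    refine Runs.three_of (d₁ := -1) (d₂ := 1) (d₃ := -1) (l₁ := 1 + 2 * (x + y) + 2 * n - p)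
      (h₁ := 1 + x + 2 * y + 2 * n) (l₂ := 2 + x + 2 * y + 2 * n)
      (h₂ := 3 * n - U + 2 * y + u + 1) (l₃ := 3 * n - U + 2 * y + u + 2)
      (h₃ := 4 * n - 2 * U + 1 + 2 * (y + u) - p) (by omega) (by omega) (by omega) fun t => ?_
    simp only [lineAB, lineTime]
    refine ⟨?_, ?_, ?_, ?_, ?_, ?_, ?_⟩ <;> omega
  by_cases hP : P p <;> by_cases hQ : Q p <;>
    simp only [hP, hQ, if_true, if_false, true_imp_iff,
      not_true, not_false_iff, false_imp_iff] at k1 k2 k3 k4 ⊢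
  -- Only two moves occur; the third run is empty.
  · refine Runs.three_of (d₁ := -1) (d₂ := 1) (d₃ := 1) (l₁ := 1 + 2 * (x + y) + 2 * n - p)
      (h₁ := 1 + x + 2 * y + 2 * n) (l₂ := 4 * n - 2 * U - x - 2 * z)
      (h₂ := 4 * n - 2 * U - 2 * (x + z) + p) (l₃ := 4 * n - 2 * U - 2 * (x + z) + p)
      (h₃ := 4 * n - 2 * U - 2 * (x + z) + p) (by omega) (by omega) (by omega) fun t => ?_
    simp only [lineAA, lineTime]
    refine ⟨?_, ?_, ?_, ?_, ?_, ?_, ?_⟩ <;> omega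
  · exact ab a b y z Y Z e E k2 hz
  · have := (ab (lineTime n U - b) (lineTime n U - a) z y Z Y (by omega) (by omega) k3 hy).reverse (lineTime n U)
    simpa only [sub_sub_cancel] using this
  · refine Runs.three_of (d₁ := 1) (d₂ := -1) (d₃ := 1) (l₁ := p + 2 * n - 2 * (z + u))
      (h₁ := 3 * n - U - 2 * z - u) (l₂ := 3 * n - U + 1 + 2 * y + u)
      (h₂ := 4 * n - 2 * U + 1 - p + 2 * (y + u)) (l₃ := 4 * n - 2 * U + 1 - p + 2 * (y + u))
      (h₃ := 4 * n - 2 * U + 1 - p + 2 * (y + u)) (by omega) (by omega) (by omega) fun t => ?_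
    simp only [lineBB, lineTime]
    refine ⟨?_, ?_, ?_, ?_, ?_, ?_, ?_⟩ <;> omega

theorem line_runs_before_cross (P Q : ℕ → Prop) {n p q : ℕ} (hpq : p < q) (hq : q < n)
    (hPp : ¬ P p) (hPq : P q) (a : ℤ) :
    Runs (line P Q n p) 1 a (crossTime P n p q) ∧ Runs (line P Q n q) 1 a (crossTime P n p q) := by
  constructor
  · refine Runs.one_of (d := 1) (Or.inl rfl) (l := p + 2 * n - 2 * (p - countBelow P p))
      fun t ht => ?_
    rw [(line_eq_of_le_crossTime P Q hpq hq hPp hPq (t := t) (by omega)).1,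
      (line_eq_of_le_crossTime P Q hpq hq hPp hPq (t := t + 1) (by omega)).1]
    omega
  · refine Runs.one_of (d := -1) (Or.inr rfl) (l := 1 + 2 * countBelow P q + 2 * n - q)
      fun t ht => ?_
    rw [(line_eq_of_le_crossTime P Q hpq hq hPp hPq (t := t) (by omega)).2,
      (line_eq_of_le_crossTime P Q hpq hq hPp hPq (t := t + 1) (by omega)).2]
    omega

/-! ### Factoring into involutions -/

/-- Every permutation is a product of two involutions. -/
theorem exists_involutive_mul {α : Type*} (σ : Equiv.Perm α) :
    ∃ J K : α → α, Function.Involutive J ∧ Function.Involutive K ∧ ∀ x, σ x = K (J x) := by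
  classical
  let s : Setoid α := Equiv.Perm.SameCycle.setoid σ
  let r : α → α := fun x => (Quotient.mk s x).out
  have hr : ∀ x, ∃ k : ℤ, (σ ^ k) (r x) = x := fun x => Quotient.mk_out (s := s) x
  have hrr : ∀ (x : α) (k : ℤ), r ((σ ^ k) x) = r x := fun x k =>
    congrArg Quotient.out (Quotient.sound (s := s) ⟨-k, by simp [← Equiv.Perm.mul_apply]⟩)
  have hidem : ∀ x, r (r x) = r x := fun x => by
    obtain ⟨k, hk⟩ := hr x
    have := hrr (r x) k
    rwa [hk, eq_comm] at this
  choose k hk using hr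
  -- Reflection of each cycle about its representative; `σ ∘ J` is again a reflection.
  let J : α → α := fun x => (σ ^ (-k x)) (r x)
  have hJ : ∀ (x : α) (m : ℤ), J ((σ ^ m) (r x)) = (σ ^ (-m)) (r x) := fun x m => by
    have h1 := hk ((σ ^ m) (r x))
    rw [hrr, hidem] at h1
    change (σ ^ (-k _)) (r _) = _
    rw [hrr, hidem]
    generalize k ((σ ^ m) (r x)) = j at h1
    have h2 : (σ ^ (-j - m)) ((σ ^ j) (r x)) = (σ ^ (-j - m)) ((σ ^ m) (r x)) := by rw [h1]
    rw [← Equiv.Perm.mul_apply, ← Equiv.Perm.mul_apply, ← zpow_add, ← zpow_add] at h2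
    rw [show -j = -j - m + m by ring, ← h2]
    congr 2
    ring
  have hJJ : Function.Involutive J := fun x => by
    have := hJ x (-k x)
    rwa [neg_neg, hk] at this
  have hJσ : ∀ x, J (σ (J (σ x))) = J (J x) := fun x => by
    have h1 : σ x = (σ ^ (1 + k x)) (r x) := by
      rw [zpow_add, Equiv.Perm.mul_apply, hk, zpow_one]
    rw [h1, hJ]
    have h2 : σ ((σ ^ (-(1 + k x))) (r x)) = J x := by
      change _ = (σ ^ (-k x)) (r x)
      rw [show -k x = 1 + -(1 + k x) by ring, zpow_add, Equiv.Perm.mul_apply, zpow_one]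
    rw [h2]
  refine ⟨J, fun x => σ (J x), hJJ, fun x => ?_, fun x => by simp only [hJJ x]⟩
  have := hJσ (J x)
  rw [hJJ (J x)] at this
  exact hJJ.injective this

/-! ### From runs to moves and tangles -/

namespace Tangle

variable {n : ℕ}

/-- Charging a move to the piece in which it starts makes the count subadditive under `append`, even
for moves straddling a cut. -/
theorem moves_starting_le (T : Tangle n) (i : Fin n) (g : ℤ → ℤ)
    (hg : ∀ t : Fin (T.len + 1), position (T.perm t) i = g (t : ℕ)) {k : ℕ} {a b : ℤ}
    (h : Runs g k a b) :
    {p : Fin (T.len + 1) × Fin (T.len + 1) |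
      T.IsMove i p.1 p.2 ∧ a ≤ (p.1 : ℕ) ∧ ((p.1 : ℕ) : ℤ) < b}.ncard ≤ k := by
  have hstep : ∀ t : Fin T.len, position (T.perm t.succ) i - position (T.perm t.castSucc) i =
      g ((t : ℕ) + 1) - g (t : ℕ) := fun t => by rw [hg, hg]; simp
  have hrun : ∀ (d : ℤ) (a b : Fin (T.len + 1)), T.IsRun i d a b ↔
      a < b ∧ ∀ t : ℕ, a.val ≤ t → t < b.val → g ((t : ℤ) + 1) - g t = d := fun d a b => by
    refine and_congr_right fun hab => ⟨fun h t h₁ h₂ => ?_, fun h t h₁ h₂ => ?_⟩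
    · have := h ⟨t, by omega⟩ h₁ (by simpa [Fin.le_def] using h₂)
      rwa [hstep] at this
    · rw [hstep]
      exact h t h₁ (by simpa [Fin.le_def] using h₂)
  induction h with
  | rest h =>
    rw [Nat.le_zero, Set.ncard_eq_zero]
    refine Set.eq_empty_of_forall_notMem ?_
    rintro ⟨c, e⟩ ⟨⟨hm, -⟩, h₁, h₂⟩
    have := h (c : ℕ) h₁ h₂
    simp only [IsSlanted, hrun] at hm
    rcases hm with hm | hm
    · have := hm.2 c le_rfl hm.1; omega
    · have := hm.2 c le_rfl hm.1; omega
  | @run a b d hd h =>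
    rw [Set.ncard_le_one]
    have key : ∀ c e c' e' : Fin (T.len + 1), T.IsMove i c e → T.IsMove i c' e' →
        a ≤ (c : ℕ) → ((c' : ℕ) : ℤ) < b → c ≤ c' → c = c' ∧ e = e' := by
      intro c e c' e' hm hm' ha hb hcc
      have hd₁ : ∀ c e : Fin (T.len + 1), T.IsMove i c e → a ≤ (c : ℕ) → ((c : ℕ) : ℤ) < b →
          c < e ∧ ∀ t : ℕ, c.val ≤ t → t < e.val → g ((t : ℤ) + 1) - g t = d := by
        rintro c e ⟨hs, -⟩ h₁ h₂
        have h₀ := h _ h₁ h₂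
        simp only [IsSlanted, hrun] at hs
        rcases hs with hs | hs
        · rw [← h₀, hs.2 c le_rfl hs.1]; exact hs
        · rw [← h₀, hs.2 c le_rfl hs.1]; exact hs
      have hcc' : c.val ≤ c'.val := hcc
      obtain ⟨m₁, m₂⟩ := hd₁ c e hm ha (by omega)
      obtain ⟨m₁', m₂'⟩ := hd₁ c' e' hm' (by omega) hb
      -- Two moves starting in one run merge into a single slanted segment, so maximality identifies
      -- both with it.
      have hu : T.IsSlanted i c (max e e') := by
        have : T.IsRun i d c (max e e') := by
          rw [hrun]
          refine ⟨lt_max_of_lt_left m₁, fun t h₁ h₂ => ?_⟩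
          rcases lt_or_ge t c'.val with h₃ | h₃
          · exact h t (by omega) (by omega)
          · rcases lt_or_ge t e'.val with h₄ | h₄
            · exact m₂' t h₃ h₄
            · refine m₂ t h₁ ?_
              rcases max_choice e e' with h₅ | h₅ <;> rw [h₅] at h₂ <;> omega
        rcases hd with rfl | rfl
        · exact Or.inl this
        · exact Or.inr this
      obtain ⟨-, q₂⟩ := hm.2 c (max e e') le_rfl (le_max_left _ _) hu
      obtain ⟨q₁', q₂'⟩ := hm'.2 c (max e e') hcc (le_max_right _ _) hu
      exact ⟨q₁', q₂.symm.trans q₂'⟩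
    rintro ⟨c, e⟩ ⟨hm, h₁, h₂⟩ ⟨c', e'⟩ ⟨hm', h₁', h₂'⟩
    rcases le_total c c' with hc | hc
    · obtain ⟨q, q'⟩ := key c e c' e' hm hm' h₁ h₂' hc
      rw [q, q']
    · obtain ⟨q, q'⟩ := key c' e' c e hm' hm h₁' h₂ hc
      rw [q, q']
  | @append k l a m b _ _ ih₁ ih₂ =>
    refine (Set.ncard_le_ncard ?_ (Set.toFinite _)).trans
      ((Set.ncard_union_le _ _).trans (add_le_add ih₁ ih₂))
    rintro p ⟨hm, h₁, h₂⟩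
    rcases lt_or_ge ((p.1 : ℕ) : ℤ) m with h | h
    · exact Or.inl ⟨hm, h₁, h⟩
    · exact Or.inr ⟨hm, h, h₂⟩

theorem moves_le (T : Tangle n) (i : Fin n) (g : ℤ → ℤ)
    (hg : ∀ t : Fin (T.len + 1), position (T.perm t) i = g (t : ℕ)) {k : ℕ}
    (h : Runs g k 0 T.len) : T.moves i ≤ k := by
  refine (Set.ncard_le_ncard ?_ (Set.toFinite _)).trans (T.moves_starting_le i g hg h)
  rintro ⟨a, b⟩ hm
  have hab : a < b := hm.1.elim (fun h => h.1) fun h => h.1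
  refine ⟨hm, by positivity, ?_⟩
  have := b.2
  have : a.val < b.val := hab
  dsimp only
  omega

end Tangle

/-- A family of integer paths that keeps distinct elements on distinct positions in `[0, n)` and
moves each element by at most one per step is the family of paths of a tangle. -/
theorem exists_tangle {n : ℕ} (N : ℕ) (g : Fin n → ℤ → ℤ)
    (hmem : ∀ i t, 0 ≤ g i t ∧ g i t < n) (hinj : ∀ t, Function.Injective fun i => g i t)
    (hstep : ∀ i t, |g i t - g i (t + 1)| ≤ 1) :
    ∃ T : Tangle n, T.len = N ∧
      ∀ (t : Fin (T.len + 1)) i, position (T.perm t) i = g i (t : ℕ) := by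
  let f : ℤ → Fin n → Fin n := fun t i => ⟨(g i t).toNat, by have := hmem i t; omega⟩
  have hf : ∀ t i, (((f t i : Fin n) : ℕ) : ℤ) = g i t := fun t i => by
    have := hmem i t
    simp only [f]
    omega
  have hfi : ∀ t, Function.Injective (f t) := fun t i j hij => hinj t (by
    have := congrArg (fun x : Fin n => ((x : ℕ) : ℤ)) hij
    simpa only [hf] using this)
  let E : ℤ → Equiv.Perm (Fin n) := fun t =>
    Equiv.ofBijective (f t) (Finite.injective_iff_bijective.mp (hfi t))
  have hE : ∀ t i, position (E t)⁻¹ i = g i t := fun t i => by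
    simp only [position, inv_inv]
    exact hf t i
  -- `E t` sends elements to positions, so the permutation in one-line notation is its inverse.
  refine ⟨⟨N, fun t => (E (t : ℕ))⁻¹, fun t i => ?_⟩, rfl, fun t i => hE _ _⟩
  rw [hE, hE]
  simpa using hstep i (t : ℕ)

theorem position_injective {n : ℕ} {π ρ : Equiv.Perm (Fin n)}
    (h : ∀ i, position π i = position ρ i) : π = ρ := by
  have : π⁻¹ = ρ⁻¹ := Equiv.ext fun i => Fin.ext (Int.ofNat_injective (h i))
  exact inv_injective this

/-! ### Riding the lines and changing at crossings -/

/-- The path of element `e` that rides its own line until it meets the line of `J e`, and that line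
from then on. -/
noncomputable def ridePath {n : ℕ} (P Q : ℕ → Prop) (J : Fin n → Fin n) (e : Fin n) (t : ℤ) : ℤ :=
  line P Q n (if t ≤ crossTime P n e (J e) then e else J e : Fin n) t

section RidePath

variable {n : ℕ} {P : ℕ → Prop} (Q : ℕ → Prop) {J : Fin n → Fin n}

theorem ridePath_mem (P : ℕ → Prop) (J : Fin n → Fin n) (e : Fin n) (t : ℤ) :
    0 ≤ ridePath P Q J e t ∧ ridePath P Q J e t < n :=
  line_mem P Q (Fin.is_lt _) t

theorem ridePath_zero (P : ℕ → Prop) (J : Fin n → Fin n) (e : Fin n) :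
    ridePath P Q J e 0 = (e : ℕ) := by
  rw [ridePath, if_pos (crossTime_nonneg P e.2), line_zero P Q e.2]

theorem ridePath_injective (P : ℕ → Prop) (hJ : Function.Involutive J) (t : ℤ) :
    Function.Injective fun e => ridePath P Q J e t := by
  have hline : ∀ p q : Fin n, line P Q n p t = line P Q n q t → p = q := by
    intro p q h
    rcases lt_trichotomy p q with hpq | hpq | hpq
    · exact absurd h (line_ne_of_lt P Q hpq q.2 t)
    · exact hpq
    · exact absurd h.symm (line_ne_of_lt P Q hpq p.2 t)
  -- Both members of a 2-cycle change at the same time, by symmetry of `crossTime`, so at each time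
  -- the assignment of lines to elements is a bijection.
  have hinv : Function.Involutive fun e : Fin n =>
      if t ≤ crossTime P n e (J e) then e else J e := by
    intro e
    by_cases h : t ≤ crossTime P n e (J e)
    · simp only [h, if_true]
    · have h' : ¬ t ≤ crossTime P n (J e) e := by rwa [crossTime_comm]
      simp only [h, if_false, h', hJ e]
  exact fun e e' h => hinv.injective (hline _ _ h)

theorem crossTime_lt_of_involutive (hJ : Function.Involutive J)
    (hP : ∀ e : Fin n, P e ↔ J e ≤ e) (e : Fin n) :
    crossTime P n e (J e) < 2 * n + countBelow P n := by
  refine crossTime_lt_max P e.2 (J e).2 ?_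
  rcases le_total e (J e) with h | h
  · rw [max_eq_right (Fin.le_def.mp h), hP, hJ]
    exact h
  · rw [max_eq_left (Fin.le_def.mp h), hP]
    exact h

theorem line_cross_of_involutive (hJ : Function.Involutive J)
    (hP : ∀ e : Fin n, P e ↔ J e ≤ e) {e : Fin n} (he : J e ≠ e) :
    line P Q n e (crossTime P n e (J e)) = line P Q n (J e) (crossTime P n e (J e) + 1) ∧
      ∀ a, Runs (line P Q n e) 1 a (crossTime P n e (J e)) := by
  rcases lt_or_gt_of_ne he with h | h
  · have h1 : ¬ P (J e) := by rw [hP, hJ]; exact not_le.mpr h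
    have h2 : P e := (hP e).mpr h.le
    rw [crossTime_comm]
    exact ⟨(line_cross P Q h e.2 h1 h2).2, fun a => (line_runs_before_cross P Q h e.2 h1 h2 a).2⟩
  · have h1 : ¬ P e := by rw [hP]; exact not_le.mpr h
    have h2 : P (J e) := by rw [hP, hJ]; exact h.le
    exact ⟨(line_cross P Q h (J e).2 h1 h2).1,
      fun a => (line_runs_before_cross P Q h (J e).2 h1 h2 a).1⟩

theorem ridePath_eq_of_lt {e : Fin n} {t : ℤ} (ht : crossTime P n e (J e) < t) :
    ridePath P Q J e t = line P Q n (J e) t := by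
  rw [ridePath, if_neg (not_le.mpr ht)]

theorem ridePath_eq_of_le {e : Fin n} {t : ℤ} (ht : t ≤ crossTime P n e (J e)) :
    ridePath P Q J e t = line P Q n e t := by
  rw [ridePath, if_pos ht]

theorem ridePath_step (hJ : Function.Involutive J) (hP : ∀ e : Fin n, P e ↔ J e ≤ e)
    (e : Fin n) (t : ℤ) : |ridePath P Q J e t - ridePath P Q J e (t + 1)| ≤ 1 := by
  rcases lt_trichotomy t (crossTime P n e (J e)) with h | h | h
  · rw [ridePath_eq_of_le Q h.le, ridePath_eq_of_le Q (Int.add_one_le_iff.mpr h)]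
    exact line_step P Q e.2 t
  · rw [ridePath_eq_of_le Q h.le, ridePath_eq_of_lt Q (by omega)]
    by_cases he : J e = e
    · rw [he]
      exact line_step P Q e.2 t
    · rw [h, (line_cross_of_involutive Q hJ hP he).1]
      simp
  · rw [ridePath_eq_of_lt Q h, ridePath_eq_of_lt Q (by omega)]
    exact line_step P Q (J e).2 t

theorem ridePath_runs (hJ : Function.Involutive J) (hP : ∀ e : Fin n, P e ↔ J e ≤ e)
    (e : Fin n) : ∃ m : ℤ, m ≤ 2 * n + countBelow P n ∧ Runs (ridePath P Q J e) 1 0 m ∧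
      ∀ t, m ≤ t → ridePath P Q J e t = line P Q n (J e) t := by
  have hlt := crossTime_lt_of_involutive hJ hP e
  by_cases he : J e = e
  · refine ⟨0, by positivity, Runs.of_le 1 le_rfl, fun t _ => ?_⟩
    rw [ridePath, he, ite_self]
  · obtain ⟨h1, h2⟩ := line_cross_of_involutive Q hJ hP he
    refine ⟨crossTime P n e (J e) + 1, by omega, Runs.append (k := 1) (l := 0)
      (m := crossTime P n e (J e)) ?_ (Runs.rest fun t ht ht' => ?_), fun t ht =>
      ridePath_eq_of_lt Q (by omega)⟩
    · exact (h2 0).congr le_rfl le_rfl fun t _ ht => ridePath_eq_of_le Q ht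
    · obtain rfl : t = crossTime P n e (J e) := by omega
      rw [ridePath_eq_of_le Q le_rfl, ridePath_eq_of_lt Q (by omega), h1, sub_self]

end RidePath

/-- A product of two involutions is performed by a tangle with at most five moves per path. -/
theorem exists_tangle_of_involutive {n : ℕ} {J K : Fin n → Fin n} (hJ : Function.Involutive J)
    (hK : Function.Involutive K) :
    ∃ T : Tangle n, (∀ i, position (T.perm 0) i = (i : ℕ)) ∧
      (∀ i, position (T.perm (Fin.last T.len)) i = (K (J i) : ℕ)) ∧ ∀ i, T.moves i ≤ 5 := by
  let P : ℕ → Prop := fun k => ∃ h : k < n, J ⟨k, h⟩ ≤ ⟨k, h⟩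
  let Q : ℕ → Prop := fun k => ∃ h : k < n, K ⟨k, h⟩ ≤ ⟨k, h⟩
  have hP : ∀ e : Fin n, P e ↔ J e ≤ e := fun e => ⟨fun h => h.2, fun h => ⟨e.2, h⟩⟩
  have hQ : ∀ e : Fin n, Q e ↔ K e ≤ e := fun e => ⟨fun h => h.2, fun h => ⟨e.2, h⟩⟩
  obtain ⟨H, hH⟩ : ∃ H : ℤ, H = 2 * n + countBelow P n := ⟨_, rfl⟩
  obtain ⟨T, hT⟩ : ∃ T : ℤ, T = totalTime P Q n := ⟨_, rfl⟩
  have hsep : H + (2 * n + countBelow Q n) ≤ T := by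
    rw [hH, hT]
    exact crossTime_separated P Q n
  let first : Fin n → ℤ → ℤ := fun e t => ridePath P Q J e t
  let second : Fin n → ℤ → ℤ := fun e t => ridePath Q P K (K (J e)) (T - t)
  -- At time `H` all `J`-changes are done and no `K`-change has occurred, so both halves ride the
  -- line of `J e` and agree there.
  let g : Fin n → ℤ → ℤ := fun e t => if t ≤ H then first e t else second e t
  have hfirst : ∀ e t, t ≤ H → g e t = first e t := fun e t h => if_pos h
  have hfirst_line : ∀ e t, H ≤ t → first e t = line P Q n (J e) t := fun e t h =>
    ridePath_eq_of_lt Q (by have := crossTime_lt_of_involutive hJ hP e; omega)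
  have hrev : ∀ e t, line Q P n (K (K (J e))) (T - t) = line P Q n (J e) t := fun e t => by
    rw [hK, hT, ← line_reverse]
  have hsecond_line : ∀ e t, t ≤ H → second e t = line P Q n (J e) t := fun e t h => by
    rw [← hrev]
    exact ridePath_eq_of_lt P (by have := crossTime_lt_of_involutive hK hQ (K (J e)); omega)
  have hsecond : ∀ e t, H ≤ t → g e t = second e t := fun e t h => by
    rcases h.eq_or_lt with h' | h'
    · rw [hfirst e t h'.ge, hfirst_line e t h, hsecond_line e t h'.ge]
    · exact if_neg (not_le.mpr h')
  have hH0 : 0 ≤ H := by rw [hH]; positivity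
  have hHT : H ≤ T := by omega
  obtain ⟨𝒯, hlen, hpos⟩ := exists_tangle T.toNat g
    (fun i t => by
      rcases le_total t H with h | h
      · rw [hfirst i t h]; exact ridePath_mem Q P J i t
      · rw [hsecond i t h]; exact ridePath_mem P Q K _ _)
    (fun t i j hij => by
      rcases le_total t H with h | h
      · simp only [hfirst _ t h] at hij
        exact ridePath_injective Q P hJ t hij
      · simp only [hsecond _ t h] at hij
        exact hJ.injective (hK.injective (ridePath_injective P Q hK (T - t) hij)))
    (fun i t => by
      rcases lt_or_ge t H with h | h
      · rw [hfirst i t h.le, hfirst i (t + 1) h]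
        exact ridePath_step Q hJ hP i t
      · rw [hsecond i t h, hsecond i (t + 1) (by omega), abs_sub_comm]
        have := ridePath_step P hK hQ (K (J i)) (T - (t + 1))
        rwa [show T - (t + 1) + 1 = T - t by ring] at this)
  have hlen' : (𝒯.len : ℤ) = T := by omega
  refine ⟨𝒯, fun i => ?_, fun i => ?_, fun i => ?_⟩
  · rw [hpos, Fin.val_zero, Nat.cast_zero, hfirst i 0 hH0]
    exact ridePath_zero Q P J i
  · rw [hpos, Fin.val_last, hlen', hsecond i T hHT]
    simp only [second, sub_self]
    exact ridePath_zero P Q K _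
  · refine 𝒯.moves_le i (g i) (fun t => hpos t i) ?_
    rw [hlen']
    obtain ⟨m, hm, r, hr⟩ := ridePath_runs Q hJ hP i
    obtain ⟨m', hm', r', hr'⟩ := ridePath_runs P hK hQ (K (J i))
    have r₁ : Runs (g i) 1 0 m := r.congr le_rfl le_rfl fun t _ h => hfirst i t (by omega)
    have r₃ : Runs (g i) 1 (T - m') T := by
      have := r'.reverse T
      rw [sub_zero] at this
      exact this.congr le_rfl le_rfl fun t h _ => hsecond i t (by omega)
    have r₂ : Runs (g i) 3 m (T - m') :=
      (line_runs P Q (J i).2 m (T - m')).congr le_rfl le_rfl fun t h h' => by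
        rcases le_total t H with k | k
        · rw [hfirst i t k]; exact hr t h
        · rw [hsecond i t k, ← hrev]; exact hr' _ (by omega)
    exact (r₁.append r₂).append r₃

theorem theorem1 (n : ℕ) (π : Equiv.Perm (Fin n)) :
    ∃ T : Tangle n, T.Performs π ∧ ∀ i : Fin n, T.moves i ≤ 5 := by
  obtain ⟨J, K, hJ, hK, h⟩ := exists_involutive_mul π⁻¹
  obtain ⟨T, h₀, h₁, hm⟩ := exists_tangle_of_involutive hJ hK
  refine ⟨T, ⟨position_injective fun i => ?_, position_injective fun i => ?_⟩, hm⟩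
  · rw [h₀]
    simp [position]
  · rw [h₁, ← h]
    rfl
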